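/- For $N\ge 1$ let $\gamma^{(N)}_0,\dots,\gamma^{(N)}_{N-2}$ and $\Lambda^{(N)}_{N-1}$ be real numbers, and let $\mathbf A^{(N)}=(\Gamma^{(N)}_{jl}-\Lambda^{(N)}_j\delta_{jl})_{j,l=0}^{N-1}$ be the matrix of the mean mode powers with nearest-neighbour coupling and dissipation in the last mode only: for $j\neq l$, $\Gamma^{(N)}_{jl}=\gamma^{(N)}_{\min(j,l)}$ if $|j-l|=1$ and $\Gamma^{(N)}_{jl}=0$ if $|j-l|\ge 2$; $\Gamma^{(N)}_{jj}=-\sum_{l\ne j}\Gamma^{(N)}_{jl}$; and $\Lambda^{(N)}_j=0$ for $j\neq N-1$. Let $-\lambda^{(N)}$ be the first (that is, largest) eigenvalue of the symmetric matrix $\mathbf A^{(N)}$. Let $\gamma_\infty\in C^\infty([0,1])$ be positive on $[0,1]$. Assume the continuum approximation in the diffusive scaling: 1. $N^{-2}\gamma^{(N)}_{\lfloor xN\rfloor}\to\gamma_\infty(x)$ as $N\to\infty$ for every $x\in(0,1)$; 2. there is $c>0$ such that, for all large $N$, $N^{-2}\gamma^{(N)}_j\ge c$ for all $0\le j\le N-2$;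 3. $\Lambda^{(N)}_{N-1}/N\to+\infty$ as $N\to\infty$. Then $\lambda^{(N)}\to\lambda$ as $N\to\infty$, where $$\lambda=\inf_{\varphi\in\mathcal D_1}\int_0^1\gamma_\infty(u)\varphi'(u)^2\,du,\qquad \mathcal D_1=\Big\{\varphi\in C^\infty([0,1]):\ \int_0^1\varphi(u)^2du=1,\ \varphi'(0)=0,\ \varphi(1)=0\Big\}.$$ Moreover, $-\lambda$ is the first (largest) eigenvalue of the operator $\varphi\mapsto\partial_u(\gamma_\infty\partial_u\varphi)$ on $[0,1]$ with the boundary conditions $\varphi'(0)=0$ and $\varphi(1)=0$. -/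

import Mathlib

open Set Filter Topology
open scoped ContDiff

namespace ContinuumApprox

noncomputable section

/-- Nearest-neighbour mode coupling coefficients `Γ_{jl}`: for `j ≠ l`, `Γ_{jl} = γ_{min(j,l)}` if
`|j - l| = 1` and `0` otherwise; on the diagonal `Γ_{jj} = - ∑_{l ≠ j} Γ_{jl}`. -/
def offDiagCoupling (N : ℕ) (γ : ℕ → ℝ) (j l : Fin N) : ℝ :=
  if (j : ℕ) + 1 = l ∨ (l : ℕ) + 1 = j then γ (min (j : ℕ) (l : ℕ)) else 0

def couplingMatrix (N : ℕ) (γ : ℕ → ℝ) : Matrix (Fin N) (Fin N) ℝ :=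
  Matrix.of fun j l =>
    if j = l then - ∑ m ∈ Finset.univ.erase j, offDiagCoupling N γ j m
    else offDiagCoupling N γ j l

/-- Dissipation is concentrated on the last mode: `Λ_{N-1} = L` and `Λ_j = 0` for `j < N - 1`. -/
def dissipation (N : ℕ) (L : ℝ) (j : Fin N) : ℝ :=
  if (j : ℕ) + 1 = N then L else 0

/-- The matrix `A = Γ - Φ` of the coupled mode power equations, `Φ = diag(Λ_j)`. -/
def modeMatrix (N : ℕ) (γ : ℕ → ℝ) (L : ℝ) : Matrix (Fin N) (Fin N) ℝ :=
  couplingMatrix N γ - Matrix.diagonal (dissipation N L)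

/-- The set of (real) eigenvalues of a real matrix. -/
def eigenvalueSet {N : ℕ} (M : Matrix (Fin N) (Fin N) ℝ) : Set ℝ :=
  {μ | Module.End.HasEigenvalue (Matrix.toLin' M) μ}

/-- The first, i.e. largest, eigenvalue. -/
def firstEigenvalue {N : ℕ} (M : Matrix (Fin N) (Fin N) ℝ) : ℝ :=
  sSup (eigenvalueSet M)

/-- Derivative on the closed interval `[0,1]` (one-sided at the endpoints). -/
def deriv01 (f : ℝ → ℝ) (u : ℝ) : ℝ := derivWithin f (Icc 0 1) u

/-- The class `𝒟₁`: `φ ∈ C^∞([0,1])`, `∫₀¹ φ² = 1`, `φ'(0) = 0`, `φ(1) = 0`. -/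
def testClass : Set (ℝ → ℝ) :=
  {φ | ContDiffOn ℝ ∞ φ (Icc 0 1) ∧
    (∫ u in (0 : ℝ)..1, φ u ^ 2) = 1 ∧ deriv01 φ 0 = 0 ∧ φ 1 = 0}

/-- `∫₀¹ γ(u) φ'(u)² du`. -/
def energy (γ φ : ℝ → ℝ) : ℝ := ∫ u in (0 : ℝ)..1, γ u * deriv01 φ u ^ 2

/-- `λ = inf_{φ ∈ 𝒟₁} ∫₀¹ γ(u) φ'(u)² du`. -/
def limitRate (γ : ℝ → ℝ) : ℝ := sInf (energy γ '' testClass)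

/-- `μ` is an eigenvalue of `φ ↦ (γ φ')'` on `[0,1]` with `φ'(0) = 0` and `φ(1) = 0`: there is a
smooth eigenfunction that does not vanish identically. -/
def IsMixedEigenvalue (γ : ℝ → ℝ) (μ : ℝ) : Prop :=
  ∃ φ : ℝ → ℝ, ContDiffOn ℝ ∞ φ (Icc 0 1) ∧ (∃ u ∈ Icc (0 : ℝ) 1, φ u ≠ 0) ∧
    deriv01 φ 0 = 0 ∧ φ 1 = 0 ∧
    ∀ u ∈ Icc (0 : ℝ) 1, deriv01 (fun v => γ v * deriv01 φ v) u = μ * φ u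

end

end ContinuumApprox

/-! The eigenvalue equation is used integrated twice. With rate `lam`, summing rows expresses the
flux through the partial sums of `u`; dividing by the coupling and summing from the right end gives
`u` as `lam` times a weighted tail sum plus a boundary term of relative size `N / Λ N`. Only
reciprocal couplings occur; after rescaling they are bounded by `c⁻¹` and converge pointwise, so
dominated convergence applies although the couplings have no uniform upper bound.

Lower bound: with mean square one, the integrated equation bounds the eigenvectors uniformly. Their
primitives are equi-Lipschitz, and Arzelà–Ascoli yields a limit point (`exists_subseq_limit`). It
solves φ(x) = μ ∫ₓ¹ γ⁻¹ ∫₀ˢ φ, which contains both boundary conditions and forces smoothness. Hence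
φ is a normalised eigenfunction with energy μ, and μ ≥ `limitRate`.

Upper bound: for ψ in `testClass`, the grid vector with flux γψ' has Rayleigh quotient tending to
the energy of ψ (`exists_upper_bound`). So every limit point of the rates equals `limitRate`, and
the limiting φ attains it. Green's identity shows that no eigenvalue exceeds `-limitRate`. -/

namespace ContinuumApprox

/-! ### Rayleigh bound for symmetric matrices. -/

open Finset in
theorem isGreatest_firstEigenvalue {N : ℕ} [NeZero N] {M : Matrix (Fin N) (Fin N) ℝ}
    (hM : M.IsHermitian) : IsGreatest (eigenvalueSet M) (firstEigenvalue M) := by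
  have hset : eigenvalueSet M = Set.range hM.eigenvalues := by
    ext μ
    rw [← hM.spectrum_real_eq_range_eigenvalues, ← Matrix.spectrum_toLin',
      ← Module.End.hasEigenvalue_iff_mem_spectrum]
    rfl
  have hfin : (eigenvalueSet M).Finite := hset ▸ Set.finite_range _
  have hne : (eigenvalueSet M).Nonempty := hset ▸ Set.range_nonempty _
  exact ⟨hne.csSup_mem hfin, fun μ hμ => le_csSup hfin.bddAbove hμ⟩

-- The spectrum of `μ - M` is nonnegative because `μ` is the largest eigenvalue, so this Hermitian
-- matrix is positive semidefinite.
open Matrix in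
theorem dotProduct_mulVec_le_firstEigenvalue {N : ℕ} [NeZero N] {M : Matrix (Fin N) (Fin N) ℝ}
    (hM : M.IsHermitian) (x : Fin N → ℝ) :
    x ⬝ᵥ (M *ᵥ x) ≤ firstEigenvalue M * (x ⬝ᵥ x) := by
  set μ := firstEigenvalue M
  have hP : (algebraMap ℝ (Matrix (Fin N) (Fin N) ℝ) μ - M).PosSemidef := by
    rw [Matrix.posSemidef_iff_isHermitian_and_spectrum_nonneg]
    refine ⟨?_, ?_⟩
    · refine Matrix.IsHermitian.sub ?_ hM
      rw [Matrix.algebraMap_eq_diagonal]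
      exact Matrix.isHermitian_diagonal _
    · rw [← spectrum.singleton_sub_eq]
      rintro _ ⟨a, ha, b, hb, rfl⟩
      rw [Set.mem_singleton_iff] at ha
      subst ha
      rw [← Matrix.spectrum_toLin', ← Module.End.hasEigenvalue_iff_mem_spectrum] at hb
      exact sub_nonneg.2 ((isGreatest_firstEigenvalue hM).2 hb)
  have h := hP.dotProduct_mulVec_nonneg x
  rw [Matrix.sub_mulVec, dotProduct_sub, Matrix.algebraMap_eq_diagonal] at h
  simp only [star_trivial] at h
  have h2 : x ⬝ᵥ (diagonal (algebraMap ℝ (Fin N → ℝ) μ) *ᵥ x) = μ * (x ⬝ᵥ x) := by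
    simp [dotProduct, mulVec_diagonal, Finset.mul_sum, mul_left_comm]
  linarith

theorem modeMatrix_isHermitian (N : ℕ) (γ : ℕ → ℝ) (L : ℝ) : (modeMatrix N γ L).IsHermitian := by
  refine Matrix.IsHermitian.sub ?_ (Matrix.isHermitian_diagonal _)
  ext i j
  simp only [couplingMatrix, offDiagCoupling, Matrix.conjTranspose_apply, Matrix.of_apply,
    star_trivial]
  by_cases h : i = j
  · subst h; rfl
  · simp only [h, Ne.symm h, if_false, or_comm, min_comm]

/-! ### The mode matrix in divergence form, and its integrated eigenvalue equation. -/

/-- The power flux `γ_k (u_{k+1} - u_k)` between the modes `k` and `k + 1`. -/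
noncomputable def flux (N : ℕ) (γ u : ℕ → ℝ) (k : ℕ) : ℝ :=
  if k + 1 < N then γ k * (u (k + 1) - u k) else 0

/-- The backward difference `f_j - f_{j-1}`, with `f_{-1} = 0`. -/
noncomputable def backwardDiff (f : ℕ → ℝ) (j : ℕ) : ℝ := f j - if j = 0 then 0 else f (j - 1)

theorem sum_backwardDiff (f : ℕ → ℝ) (k : ℕ) : ∑ j ∈ Finset.range (k + 1), backwardDiff f j = f k := by
  induction k with
  | zero => simp [backwardDiff]
  | succ k ih => rw [Finset.sum_range_succ, ih]; simp [backwardDiff]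

/-- Abel summation; the convention `f_{-1} = 0` is the reflecting end at mode zero and removes the
lower boundary term. -/
theorem sum_mul_backwardDiff (f u : ℕ → ℝ) (k : ℕ) :
    ∑ j ∈ Finset.range (k + 1), u j * backwardDiff f j =
      u k * f k - ∑ j ∈ Finset.range k, f j * (u (j + 1) - u j) := by
  induction k with
  | zero => simp [backwardDiff]
  | succ k ih =>
    rw [Finset.sum_range_succ, ih, Finset.sum_range_succ]
    simp [backwardDiff]; ring

open Matrix in
theorem modeMatrix_mulVec (N : ℕ) (γ : ℕ → ℝ) (L : ℝ) (u : ℕ → ℝ) (j : Fin N) :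
    (modeMatrix N γ L *ᵥ fun i => u i) j =
      backwardDiff (flux N γ u) j - if (j : ℕ) + 1 = N then L * u j else 0 := by
  have hdiag : offDiagCoupling N γ j j = 0 := by simp [offDiagCoupling]
  have hS : ∑ m ∈ Finset.univ.erase j, offDiagCoupling N γ j m = ∑ m, offDiagCoupling N γ j m := by
    rw [← Finset.add_sum_erase _ _ (Finset.mem_univ j), hdiag, zero_add]
  have hC : (couplingMatrix N γ *ᵥ fun i => u i) j =
      ∑ l : Fin N, offDiagCoupling N γ j l * (u l - u j) := by
    have : ∀ l : Fin N, couplingMatrix N γ j l * u l =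
        offDiagCoupling N γ j l * u l +
          if j = l then -(∑ m, offDiagCoupling N γ j m) * u j else 0 := by
      intro l
      by_cases h : j = l
      · subst h; simp [couplingMatrix, hdiag]
      · simp [couplingMatrix, h]
    simp only [mulVec, dotProduct, this, Finset.sum_add_distrib, Finset.sum_ite_eq,
      Finset.mem_univ, if_true, mul_sub, Finset.sum_sub_distrib, Finset.sum_mul, neg_mul]
    ring
  have hE : ∑ l : Fin N, offDiagCoupling N γ j l * (u l - u j) =
      ∑ l ∈ Finset.range N, ((if (j : ℕ) + 1 = l then γ j * (u (j + 1) - u j) else 0) +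
        if j = l + 1 then γ l * (u l - u j) else 0) := by
    rw [← Fin.sum_univ_eq_sum_range]
    refine Finset.sum_congr rfl fun l _ => ?_
    unfold offDiagCoupling
    by_cases h1 : (j : ℕ) + 1 = l
    · have h2 : ¬ (j : ℕ) = l + 1 := by omega
      have h3 : min (j : ℕ) l = j := by omega
      have h4 : ¬ (j : ℕ) = j + 1 + 1 := by omega
      simp [← h1, h4]
    · by_cases h2 : (j : ℕ) = l + 1
      · have h3 : ¬ (l : ℕ) + 1 + 1 = l := by omega
        simp [h2, h3]
      · have h4 : ¬ (l : ℕ) + 1 = j := fun h => h2 h.symm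
        simp [h1, h2, h4]
  have hP : ∑ l ∈ Finset.range N, (if (j : ℕ) = l + 1 then γ l * (u l - u j) else 0) =
      - if (j : ℕ) = 0 then 0 else flux N γ u (j - 1) := by
    obtain ⟨j, hj⟩ := j
    rcases j with _ | k
    · simp
    · simp [flux, hj, show k < N by omega]
      ring
  rw [modeMatrix, sub_mulVec, Pi.sub_apply, hC, hE, Finset.sum_add_distrib, Finset.sum_ite_eq, hP,
    mulVec_diagonal, backwardDiff, dissipation]
  simp only [Finset.mem_range, flux, ite_mul, zero_mul]
  ring

/-- The rate `λ = -(first eigenvalue)`. -/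
noncomputable def decayRate (N : ℕ) (γ : ℕ → ℝ) (L : ℝ) : ℝ := -firstEigenvalue (modeMatrix N γ L)

-- Abel summation produces the Dirichlet form; the upper boundary term disappears because the flux
-- out of mode `n` is set to zero.
open Matrix in
theorem dotProduct_modeMatrix_mulVec (n : ℕ) (γ : ℕ → ℝ) (L : ℝ) (u : ℕ → ℝ) :
    (fun i : Fin (n + 1) => u i) ⬝ᵥ (modeMatrix (n + 1) γ L *ᵥ fun i => u i) =
      -(∑ k ∈ Finset.range n, γ k * (u (k + 1) - u k) ^ 2 + L * u n ^ 2) := by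
  simp only [dotProduct, modeMatrix_mulVec]
  rw [Fin.sum_univ_eq_sum_range (fun j => u j * (backwardDiff (flux (n + 1) γ u) j -
    if j + 1 = n + 1 then L * u j else 0))]
  simp only [mul_sub, Finset.sum_sub_distrib]
  rw [sum_mul_backwardDiff]
  have h1 : ∑ j ∈ Finset.range n, flux (n + 1) γ u j * (u (j + 1) - u j) =
      ∑ k ∈ Finset.range n, γ k * (u (k + 1) - u k) ^ 2 := by
    refine Finset.sum_congr rfl fun k hk => ?_
    have := Finset.mem_range.1 hk
    simp only [flux, Nat.add_lt_add_iff_right, this, if_true]; ring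
  rw [h1]
  simp [flux]
  ring

/-- The variational bound for the decay rate. -/
theorem decayRate_mul_sum_sq_le (n : ℕ) (γ : ℕ → ℝ) (L : ℝ) (v : ℕ → ℝ) :
    decayRate (n + 1) γ L * ∑ j ∈ Finset.range (n + 1), v j ^ 2 ≤
      ∑ k ∈ Finset.range n, γ k * (v (k + 1) - v k) ^ 2 + L * v n ^ 2 := by
  have h := dotProduct_mulVec_le_firstEigenvalue (modeMatrix_isHermitian (n + 1) γ L)
    (fun i => v i)
  rw [dotProduct_modeMatrix_mulVec] at h
  have h2 : (dotProduct (fun i : Fin (n + 1) => v i) fun i => v i) =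
      ∑ j ∈ Finset.range (n + 1), v j ^ 2 := by
    rw [← Fin.sum_univ_eq_sum_range (fun j => v j ^ 2)]
    simp [dotProduct, sq]
  rw [h2] at h
  unfold decayRate
  linarith

/-- The reciprocals of the coupling coefficients, extended by zero. -/
noncomputable def resistance (N : ℕ) (γ : ℕ → ℝ) (k : ℕ) : ℝ := if k + 1 < N then (γ k)⁻¹ else 0

/-- A principal eigenvector, normalised to mean square one, in the integrated form of the
eigenvalue equation. -/
theorem exists_principal_eigenvector (n : ℕ) (γ : ℕ → ℝ) (L : ℝ) (hγ : ∀ k < n, 0 < γ k)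
    (hL : 0 < L) :
    0 ≤ decayRate (n + 1) γ L ∧ ∃ u : ℕ → ℝ, (∀ j, n + 1 ≤ j → u j = 0) ∧
      ∑ j ∈ Finset.range (n + 1), u j ^ 2 = (n + 1 : ℕ) ∧
      ∀ j < n + 1, u j = decayRate (n + 1) γ L *
        (∑ k ∈ Finset.Ico j (n + 1),
          resistance (n + 1) γ k * ∑ i ∈ Finset.range (k + 1), u i +
            (1 / L) * ∑ i ∈ Finset.range (n + 1), u i) := by
  obtain ⟨w, hw⟩ := (isGreatest_firstEigenvalue
    (modeMatrix_isHermitian (n + 1) γ L)).1.exists_hasEigenvector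
  set u₀ : ℕ → ℝ := fun j => if h : j < n + 1 then w ⟨j, h⟩ else 0 with hu₀
  have hu₀w : (fun i : Fin (n + 1) => u₀ i) = w := by
    ext i
    exact dif_pos i.isLt
  have hpos : 0 < ∑ j ∈ Finset.range (n + 1), u₀ j ^ 2 := by
    rw [← Fin.sum_univ_eq_sum_range (fun j => u₀ j ^ 2)]
    obtain ⟨i, hi⟩ := Function.ne_iff.1 hw.2
    refine Finset.sum_pos' (fun _ _ => sq_nonneg _) ⟨i, Finset.mem_univ _, ?_⟩
    have : u₀ i = w i := congrFun hu₀w i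
    rw [this]
    exact sq_pos_of_ne_zero hi
  have heig : Matrix.mulVec (modeMatrix (n + 1) γ L) (fun i => u₀ i) =
      -decayRate (n + 1) γ L • fun i : Fin (n + 1) => u₀ i := by
    rw [hu₀w, decayRate, neg_neg]
    simpa using hw.apply_eq_smul
  have hnonneg : 0 ≤ decayRate (n + 1) γ L := by
    have h := dotProduct_modeMatrix_mulVec n γ L u₀
    rw [heig, dotProduct_smul] at h
    have h2 : (dotProduct (fun i : Fin (n + 1) => u₀ i) fun i => u₀ i) =
        ∑ j ∈ Finset.range (n + 1), u₀ j ^ 2 := by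
      rw [← Fin.sum_univ_eq_sum_range (fun j => u₀ j ^ 2)]
      simp [dotProduct, sq]
    rw [h2, smul_eq_mul] at h
    have h3 : 0 ≤ ∑ k ∈ Finset.range n, γ k * (u₀ (k + 1) - u₀ k) ^ 2 + L * u₀ n ^ 2 :=
      add_nonneg (Finset.sum_nonneg fun k hk =>
        mul_nonneg (hγ k (Finset.mem_range.1 hk)).le (sq_nonneg _)) (by positivity)
    refine nonneg_of_mul_nonneg_left ?_ hpos
    linarith
  have hpt : ∀ j < n + 1, backwardDiff (flux (n + 1) γ u₀) j - (if j + 1 = n + 1 then L * u₀ j else 0)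
      = -decayRate (n + 1) γ L * u₀ j := by
    intro j hj
    rw [← modeMatrix_mulVec (n + 1) γ L u₀ ⟨j, hj⟩, heig]
    rfl
  -- Rows `0, …, k` telescope to the flux at `k`; none of them carries dissipation, since `k < n`.
  have hflux : ∀ k < n, u₀ k - u₀ (k + 1) =
      decayRate (n + 1) γ L * (resistance (n + 1) γ k * ∑ i ∈ Finset.range (k + 1), u₀ i) := by
    intro k hk
    have h1 : flux (n + 1) γ u₀ k = ∑ j ∈ Finset.range (k + 1), -decayRate (n + 1) γ L * u₀ j := by
      rw [← sum_backwardDiff (flux (n + 1) γ u₀) k]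
      refine Finset.sum_congr rfl fun j hj => ?_
      have hj' := Finset.mem_range.1 hj
      rw [← hpt j (by omega), if_neg (by omega), sub_zero]
    rw [← Finset.mul_sum] at h1
    have h2 := (hγ k hk).ne'
    simp only [flux, resistance, Nat.add_lt_add_iff_right, hk, if_true] at h1 ⊢
    field_simp
    linarith
  -- Summing all rows leaves no flux at either end, so dissipation in the last mode balances the
  -- whole sum.
  have hend : u₀ n = decayRate (n + 1) γ L * (1 / L * ∑ i ∈ Finset.range (n + 1), u₀ i) := by
    have h1 : ∑ j ∈ Finset.range (n + 1), (backwardDiff (flux (n + 1) γ u₀) j -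
        (if j + 1 = n + 1 then L * u₀ j else 0)) =
        ∑ j ∈ Finset.range (n + 1), -decayRate (n + 1) γ L * u₀ j :=
      Finset.sum_congr rfl fun j hj => hpt j (Finset.mem_range.1 hj)
    rw [Finset.sum_sub_distrib, sum_backwardDiff, ← Finset.mul_sum] at h1
    simp [flux] at h1
    field_simp
    linarith
  have hint : ∀ j < n + 1, u₀ j = decayRate (n + 1) γ L *
        (∑ k ∈ Finset.Ico j (n + 1),
          resistance (n + 1) γ k * ∑ i ∈ Finset.range (k + 1), u₀ i +
            (1 / L) * ∑ i ∈ Finset.range (n + 1), u₀ i) := by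
    intro j hj
    rw [mul_add, ← hend, Finset.sum_Ico_succ_top (by omega)]
    have h0 : resistance (n + 1) γ n = 0 := by simp [resistance]
    rw [h0, zero_mul, add_zero, Finset.mul_sum]
    have h1 : ∑ k ∈ Finset.Ico j n, (u₀ (k + 1) - u₀ k) = u₀ n - u₀ j :=
      Finset.sum_Ico_sub u₀ (by omega)
    have h2 : ∑ k ∈ Finset.Ico j n, decayRate (n + 1) γ L *
        (resistance (n + 1) γ k * ∑ i ∈ Finset.range (k + 1), u₀ i) = u₀ j - u₀ n := by
      rw [← neg_sub, ← h1, ← Finset.sum_neg_distrib]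
      refine Finset.sum_congr rfl fun k hk => ?_
      rw [← hflux k (Finset.mem_Ico.1 hk).2, neg_sub]
    rw [h2]; ring
  -- The equation is linear, so scaling is free; this factor makes the associated step function of
  -- unit norm in L²(0,1).
  refine ⟨hnonneg, fun j => √((n + 1 : ℕ) / ∑ j ∈ Finset.range (n + 1), u₀ j ^ 2) * u₀ j,
    fun j hj => ?_, ?_, fun j hj => ?_⟩
  · have h0 : u₀ j = 0 := dif_neg (by omega)
    simp [h0]
  · simp only [mul_pow]
    rw [← Finset.mul_sum, Real.sq_sqrt (by positivity)]
    field_simp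
  · beta_reduce
    rw [hint j hj]
    simp only [← Finset.mul_sum, mul_left_comm _ (√_)]
    ring

/-! ### Riemann sums as integrals of step functions. -/

open MeasureTheory intervalIntegral

theorem intervalIntegrable_of_abs_le {f : ℝ → ℝ} {C : ℝ} (hf : Measurable f)
    (hb : ∀ t, |f t| ≤ C) (a b : ℝ) : IntervalIntegrable f volume a b :=
  (intervalIntegrable_const (c := C)).mono_fun' hf.aestronglyMeasurable
    (Eventually.of_forall fun t => hb t)

theorem measurable_comp_floor_mul (a : ℕ → ℝ) (c : ℝ) : Measurable fun x : ℝ => a ⌊x * c⌋₊ :=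
  measurable_from_nat.comp (Nat.measurable_floor.comp (measurable_id.mul_const c))

/-- The integral of a step function with mesh `1 / N` is a Riemann sum. -/
theorem integral_comp_floor_mul (a : ℕ → ℝ) {N m n : ℕ} (hN : 0 < N) (h : m ≤ n) :
    ∫ x in (m / N : ℝ)..(n / N), a ⌊x * N⌋₊ = (∑ k ∈ Finset.Ico m n, a k) / N := by
  have hN' : (0 : ℝ) < N := by exact_mod_cast hN
  have hfloor : ∀ k : ℕ, ∀ x ∈ Ioo (k / N : ℝ) ((k + 1 : ℕ) / N), a ⌊x * N⌋₊ = a k := by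
    intro k x hx
    congr 1
    have h1 := (div_lt_iff₀ hN').1 hx.1
    have h2 := (lt_div_iff₀ hN').1 hx.2
    push_cast at h2
    exact (Nat.floor_eq_iff ((Nat.cast_nonneg k).trans h1.le)).2 ⟨h1.le, h2⟩
  have hle : ∀ k : ℕ, (k / N : ℝ) ≤ (k + 1 : ℕ) / N := fun k => by
    push_cast
    gcongr
    linarith
  have hae : ∀ k : ℕ, ∀ᵐ x : ℝ, x ∈ Set.uIoc (k / N : ℝ) ((k + 1 : ℕ) / N) → a ⌊x * N⌋₊ = a k := by
    intro k
    -- At the right endpoint of the cell the floor is already `k + 1`; that point is null.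
    have : ∀ᵐ x : ℝ, x ≠ ((k + 1 : ℕ) / N : ℝ) := by simp [ae_iff, measure_singleton]
    filter_upwards [this] with x hx hx'
    rw [uIoc_of_le (hle k)] at hx'
    exact hfloor k x ⟨hx'.1, lt_of_le_of_ne hx'.2 hx⟩
  have hint : ∀ k : ℕ, IntervalIntegrable (fun x : ℝ => a ⌊x * N⌋₊) volume
      (k / N : ℝ) ((k + 1 : ℕ) / N) := by
    intro k
    refine (intervalIntegrable_const (c := a k)).congr_ae ?_
    rw [EventuallyEq, ae_restrict_iff' measurableSet_uIoc]
    filter_upwards [hae k] with x hx hx'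
    exact (hx hx').symm
  rw [← sum_integral_adjacent_intervals_Ico (a := fun k : ℕ => (k / N : ℝ)) h fun k _ => hint k,
    Finset.sum_div]
  refine Finset.sum_congr rfl fun k _ => ?_
  rw [intervalIntegral.integral_congr_ae (hae k), intervalIntegral.integral_const, smul_eq_mul]
  push_cast
  ring

theorem tendsto_integral_of_bounded {F : ℕ → ℝ → ℝ} {f : ℝ → ℝ} {C a b : ℝ}
    (hF : ∀ n, Measurable (F n)) (hb : ∀ n t, |F n t| ≤ C)
    (hlim : ∀ t ∈ Ioo (0 : ℝ) 1, Tendsto (fun n => F n t) atTop (𝓝 (f t)))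
    (ha : a ∈ Icc (0 : ℝ) 1) (hb' : b ∈ Icc (0 : ℝ) 1) :
    Tendsto (fun n => ∫ t in a..b, F n t) atTop (𝓝 (∫ t in a..b, f t)) := by
  refine tendsto_integral_filter_of_dominated_convergence (fun _ => C)
    (Eventually.of_forall fun n => (hF n).aestronglyMeasurable)
    (Eventually.of_forall fun n => Eventually.of_forall fun t _ => hb n t)
    intervalIntegrable_const ?_
  have : ∀ᵐ x : ℝ, x ≠ 1 := by simp [ae_iff, measure_singleton]
  filter_upwards [this] with x hx hx'
  have h1 := le_max_iff.1 hx'.2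
  have h0 := min_lt_iff.1 hx'.1
  refine hlim x ⟨?_, lt_of_le_of_ne ?_ hx⟩
  · rcases h0 with h | h <;> linarith [ha.1, hb'.1]
  · rcases h1 with h | h <;> linarith [ha.2, hb'.2]

/-- Moving the lower limit costs at most `C * |x - y n|`. This is needed because grid tails start at
`⌊x * N⌋₊ / N`, not at `x`. -/
theorem tendsto_integral_tail {F : ℕ → ℝ → ℝ} {f : ℝ → ℝ} {C x : ℝ} {y : ℕ → ℝ}
    (hF : ∀ n, Measurable (F n)) (hb : ∀ n t, |F n t| ≤ C)
    (hlim : ∀ t ∈ Ioo (0 : ℝ) 1, Tendsto (fun n => F n t) atTop (𝓝 (f t)))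
    (hx : x ∈ Icc (0 : ℝ) 1) (hy : Tendsto y atTop (𝓝 x)) :
    Tendsto (fun n => ∫ t in (y n)..1, F n t) atTop (𝓝 (∫ t in x..1, f t)) := by
  have h1 := tendsto_integral_of_bounded hF hb hlim hx (right_mem_Icc.2 zero_le_one)
  have h2 : Tendsto (fun n => ∫ t in (y n)..x, F n t) atTop (𝓝 0) := by
    refine squeeze_zero_norm (a := fun n => C * |x - y n|)
      (fun n => norm_integral_le_of_norm_le_const fun t _ => hb n t) ?_
    have : Tendsto (fun n => x - y n) atTop (𝓝 0) := by simpa using hy.const_sub x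
    simpa using this.abs.const_mul C
  have h3 := h2.add h1
  rw [zero_add] at h3
  refine h3.congr fun n => ?_
  exact integral_add_adjacent_intervals (intervalIntegrable_of_abs_le (hF n) (hb n) _ _)
    (intervalIntegrable_of_abs_le (hF n) (hb n) _ _)

/-! ### Calculus on the closed interval and the integrated eigenvalue problem. -/

theorem hasDerivWithinAt_integral {f : ℝ → ℝ} (hf : ContinuousOn f (Icc 0 1)) {x : ℝ}
    (hx : x ∈ Icc (0 : ℝ) 1) :
    HasDerivWithinAt (fun x => ∫ t in (0 : ℝ)..x, f t) (f x) (Icc 0 1) x := by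
  set g : ℝ → ℝ := IccExtend zero_le_one ((Icc (0 : ℝ) 1).domRestrict f) with hg
  have hgc : Continuous g := hf.domRestrict.Icc_extend'
  have hfg : ∀ t ∈ Icc (0 : ℝ) 1, g t = f t := fun t ht => IccExtend_of_mem _ _ ht
  have hd : HasDerivWithinAt (fun x => ∫ t in (0 : ℝ)..x, g t) (g x) (Icc 0 1) x :=
    (integral_hasDerivAt_right (hgc.intervalIntegrable _ _)
      (hgc.stronglyMeasurableAtFilter _ _) hgc.continuousAt).hasDerivWithinAt
  rw [hfg x hx] at hd
  have heq : ∀ y ∈ Icc (0 : ℝ) 1, ∫ t in (0 : ℝ)..y, f t = ∫ t in (0 : ℝ)..y, g t := by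
    intro y hy
    refine integral_congr fun t ht => (hfg t ?_).symm
    rw [uIcc_of_le hy.1] at ht
    exact ⟨ht.1, ht.2.trans hy.2⟩
  exact hd.congr heq (heq x hx)

theorem deriv01_eq {f : ℝ → ℝ} {f' x : ℝ} (hx : x ∈ Icc (0 : ℝ) 1)
    (h : HasDerivWithinAt f f' (Icc 0 1) x) : deriv01 f x = f' :=
  h.derivWithin (uniqueDiffOn_Icc zero_lt_one x hx)

theorem contDiffOn_integral {f : ℝ → ℝ} {n : ℕ} (hf : ContDiffOn ℝ n f (Icc 0 1)) :
    ContDiffOn ℝ (n + 1 : ℕ) (fun x => ∫ t in (0 : ℝ)..x, f t) (Icc 0 1) := by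
  push_cast
  rw [contDiffOn_succ_iff_derivWithin (uniqueDiffOn_Icc zero_lt_one)]
  refine ⟨fun x hx => (hasDerivWithinAt_integral hf.continuousOn hx).differentiableWithinAt,
    by simp, hf.congr fun x hx => deriv01_eq hx (hasDerivWithinAt_integral hf.continuousOn hx)⟩

theorem integral_tail_eq {f : ℝ → ℝ} (hf : ContinuousOn f (Icc 0 1)) {x : ℝ}
    (hx : x ∈ Icc (0 : ℝ) 1) :
    ∫ t in x..1, f t = (∫ t in (0 : ℝ)..1, f t) - ∫ t in (0 : ℝ)..x, f t := by
  have h : ∀ a ∈ Icc (0 : ℝ) 1, IntervalIntegrable f volume 0 a := fun a ha =>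
    (hf.mono (by rw [uIcc_of_le ha.1]; exact Icc_subset_Icc_right ha.2)).intervalIntegrable
  rw [integral_interval_sub_left (h 1 (right_mem_Icc.2 zero_le_one)) (h x hx)]

/-- `φ` solves `(γ φ')' = -μ φ`, `φ'(0) = 0`, `φ(1) = 0` in integrated form. -/
structure IsIntegratedSolution (γ : ℝ → ℝ) (μ : ℝ) (φ : ℝ → ℝ) : Prop where
  continuousOn : ContinuousOn φ (Icc 0 1)
  eq_integral : ∀ x ∈ Icc (0 : ℝ) 1, φ x = μ * ∫ s in x..1, (∫ t in (0 : ℝ)..s, φ t) / γ s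

namespace IsIntegratedSolution
variable {γ φ : ℝ → ℝ} {μ : ℝ}

theorem continuousOn_div (h : IsIntegratedSolution γ μ φ) (hγ : ContinuousOn γ (Icc 0 1))
    (hpos : ∀ u ∈ Icc (0 : ℝ) 1, 0 < γ u) :
    ContinuousOn (fun s => (∫ t in (0 : ℝ)..s, φ t) / γ s) (Icc 0 1) :=
  ContinuousOn.div (fun _ hx => (hasDerivWithinAt_integral h.continuousOn hx).continuousWithinAt)
    hγ fun x hx => (hpos x hx).ne'

theorem eq_sub (h : IsIntegratedSolution γ μ φ) (hγ : ContinuousOn γ (Icc 0 1))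
    (hpos : ∀ u ∈ Icc (0 : ℝ) 1, 0 < γ u) {x : ℝ} (hx : x ∈ Icc (0 : ℝ) 1) :
    φ x = μ * ((∫ s in (0 : ℝ)..1, (∫ t in (0 : ℝ)..s, φ t) / γ s) -
      ∫ s in (0 : ℝ)..x, (∫ t in (0 : ℝ)..s, φ t) / γ s) := by
  rw [h.eq_integral x hx, integral_tail_eq (h.continuousOn_div hγ hpos) hx]

/-- Bootstrap: the right-hand side of the integral equation gains derivatives over `φ`, so
regularity climbs from continuity to all orders. -/
theorem contDiffOn (h : IsIntegratedSolution γ μ φ) (hγ : ContDiffOn ℝ ∞ γ (Icc 0 1))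
    (hpos : ∀ u ∈ Icc (0 : ℝ) 1, 0 < γ u) : ContDiffOn ℝ ∞ φ (Icc 0 1) := by
  rw [contDiffOn_infty]
  intro n
  induction n with
  | zero => exact contDiffOn_zero.2 h.continuousOn
  | succ n ih =>
    have h1 : ContDiffOn ℝ n (fun s => (∫ t in (0 : ℝ)..s, φ t) / γ s) (Icc 0 1) :=
      ((contDiffOn_integral ih).of_le (by exact_mod_cast n.le_succ)).div
        (contDiffOn_infty.1 hγ n) fun x hx => (hpos x hx).ne'
    exact (contDiffOn_const.mul (contDiffOn_const.sub (contDiffOn_integral h1))).congr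
      fun x hx => h.eq_sub hγ.continuousOn hpos hx

theorem deriv01_eq (h : IsIntegratedSolution γ μ φ) (hγ : ContinuousOn γ (Icc 0 1))
    (hpos : ∀ u ∈ Icc (0 : ℝ) 1, 0 < γ u) {x : ℝ} (hx : x ∈ Icc (0 : ℝ) 1) :
    deriv01 φ x = -μ * ((∫ t in (0 : ℝ)..x, φ t) / γ x) := by
  have h1 := ((hasDerivWithinAt_integral (h.continuousOn_div hγ hpos) hx).const_sub
    (∫ s in (0 : ℝ)..1, (∫ t in (0 : ℝ)..s, φ t) / γ s)).const_mul μ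
  refine ContinuumApprox.deriv01_eq hx ((h1.congr (fun y hy => h.eq_sub hγ hpos hy)
    (h.eq_sub hγ hpos hx)).congr_deriv (by ring))

theorem isMixedEigenvalue_data (h : IsIntegratedSolution γ μ φ) (hγ : ContDiffOn ℝ ∞ γ (Icc 0 1))
    (hpos : ∀ u ∈ Icc (0 : ℝ) 1, 0 < γ u) :
    deriv01 φ 0 = 0 ∧ φ 1 = 0 ∧
      ∀ u ∈ Icc (0 : ℝ) 1, deriv01 (fun v => γ v * deriv01 φ v) u = -μ * φ u := by
  refine ⟨?_, ?_, fun u hu => ?_⟩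
  · rw [h.deriv01_eq hγ.continuousOn hpos (left_mem_Icc.2 zero_le_one)]
    simp
  · rw [h.eq_integral 1 (right_mem_Icc.2 zero_le_one)]
    simp
  · have heq : ∀ y ∈ Icc (0 : ℝ) 1, γ y * deriv01 φ y = -μ * ∫ t in (0 : ℝ)..y, φ t := by
      intro y hy
      rw [h.deriv01_eq hγ.continuousOn hpos hy]
      have := (hpos y hy).ne'
      field_simp
    exact ContinuumApprox.deriv01_eq hu
      (((hasDerivWithinAt_integral h.continuousOn hu).const_mul (-μ)).congr heq (heq u hu))

end IsIntegratedSolution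

theorem contDiffOn_deriv01 {φ : ℝ → ℝ} (hφ : ContDiffOn ℝ ∞ φ (Icc 0 1)) :
    ContDiffOn ℝ ∞ (deriv01 φ) (Icc 0 1) :=
  hφ.derivWithin (uniqueDiffOn_Icc zero_lt_one) (by simp)

theorem hasDerivWithinAt_deriv01 {φ : ℝ → ℝ} (hφ : ContDiffOn ℝ ∞ φ (Icc 0 1)) {x : ℝ}
    (hx : x ∈ Icc (0 : ℝ) 1) : HasDerivWithinAt φ (deriv01 φ x) (Icc 0 1) x :=
  (hφ.differentiableOn (by simp) x hx).hasDerivWithinAt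

theorem integral_eq_sub_of_hasDerivWithinAt {f f' : ℝ → ℝ} {a b : ℝ} (ha : 0 ≤ a) (hab : a ≤ b)
    (hb : b ≤ 1)
    (h : ∀ x ∈ Icc (0 : ℝ) 1, HasDerivWithinAt f (f' x) (Icc 0 1) x)
    (hc : ContinuousOn f' (Icc 0 1)) : ∫ x in a..b, f' x = f b - f a := by
  have hsub : Icc a b ⊆ Icc 0 1 := Icc_subset_Icc ha hb
  refine integral_eq_sub_of_hasDeriv_right_of_le hab
    (fun x hx => ((h x (hsub hx)).continuousWithinAt).mono hsub) (fun x hx => ?_)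
    (hc.mono (by rwa [uIcc_of_le hab])).intervalIntegrable
  exact ((h x (hsub (Ioo_subset_Icc_self hx))).hasDerivAt
    (Icc_mem_nhds (ha.trans_lt hx.1) (hx.2.trans_le hb))).hasDerivWithinAt

/-- Green's identity for an eigenfunction. -/
theorem energy_eq_of_eigen {γ φ : ℝ → ℝ} {μ : ℝ} (hγ : ContDiffOn ℝ ∞ γ (Icc 0 1))
    (hφ : ContDiffOn ℝ ∞ φ (Icc 0 1)) (h0 : deriv01 φ 0 = 0) (h1 : φ 1 = 0)
    (heq : ∀ u ∈ Icc (0 : ℝ) 1, deriv01 (fun v => γ v * deriv01 φ v) u = μ * φ u) :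
    energy γ φ = -μ * ∫ u in (0 : ℝ)..1, φ u ^ 2 := by
  have hflux : ContDiffOn ℝ ∞ (fun v => γ v * deriv01 φ v) (Icc 0 1) :=
    hγ.mul (contDiffOn_deriv01 hφ)
  have hderiv : ∀ x ∈ Icc (0 : ℝ) 1, HasDerivWithinAt (fun v => γ v * deriv01 φ v * φ v)
      (μ * φ x ^ 2 + γ x * deriv01 φ x ^ 2) (Icc 0 1) x := by
    intro x hx
    have h2 := (hasDerivWithinAt_deriv01 hflux hx).mul (hasDerivWithinAt_deriv01 hφ hx)
    rw [heq x hx] at h2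
    exact h2.congr_deriv (by ring)
  have hc1 : ContinuousOn (fun x => μ * φ x ^ 2) (Icc 0 1) :=
    continuousOn_const.mul (hφ.continuousOn.pow 2)
  have hc2 : ContinuousOn (fun x => γ x * deriv01 φ x ^ 2) (Icc 0 1) :=
    hγ.continuousOn.mul ((contDiffOn_deriv01 hφ).continuousOn.pow 2)
  have h3 := integral_eq_sub_of_hasDerivWithinAt le_rfl zero_le_one le_rfl hderiv (hc1.add hc2)
  have hu : uIcc (0 : ℝ) 1 = Icc 0 1 := uIcc_of_le zero_le_one
  rw [intervalIntegral.integral_add (hu ▸ hc1).intervalIntegrable (hu ▸ hc2).intervalIntegrable, h0, h1] at h3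
  simp only [intervalIntegral.integral_const_mul] at h3
  unfold energy
  linarith

/-! ### Uniform estimates and limits of weighted grid sums. -/

theorem tendsto_floor_mul_div {m : ℕ → ℕ} (hm : Tendsto m atTop atTop) {x : ℝ} (hx : 0 ≤ x) :
    Tendsto (fun n => (⌊x * m n⌋₊ : ℝ) / m n) atTop (𝓝 x) :=
  (tendsto_nat_floor_mul_div_atTop hx).comp (tendsto_natCast_atTop_atTop.comp hm)

/-- Coefficients `W n k` on grids with `m n` points, bounded by `C` and converging pointwise to the
reciprocal of `γ`. -/
structure ResistanceSequence (γ : ℝ → ℝ) (C : ℝ) (m : ℕ → ℕ) (W : ℕ → ℕ → ℝ) : Prop where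
  pos : ∀ n, 0 < m n
  tendsto_size : Tendsto m atTop atTop
  abs_le : ∀ n k, |W n k| ≤ C
  tendsto : ∀ x ∈ Ioo (0 : ℝ) 1, Tendsto (fun n => W n ⌊x * m n⌋₊) atTop (𝓝 (γ x)⁻¹)

namespace ResistanceSequence
variable {γ : ℝ → ℝ} {C : ℝ} {m : ℕ → ℕ} {W : ℕ → ℕ → ℝ}

theorem comp (h : ResistanceSequence γ C m W) {s : ℕ → ℕ} (hs : Tendsto s atTop atTop) :
    ResistanceSequence γ C (fun n => m (s n)) (fun n => W (s n)) where
  pos _ := h.pos _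
  tendsto_size := h.tendsto_size.comp hs
  abs_le _ := h.abs_le _
  tendsto x hx := (h.tendsto x hx).comp hs

theorem nonneg (h : ResistanceSequence γ C m W) : 0 ≤ C := (abs_nonneg _).trans (h.abs_le 0 0)

/-- Tail Riemann sums weighted by the coefficients converge to the tail integral. -/
theorem tendsto_tail_sum (h : ResistanceSequence γ C m W) {p : ℕ → ℕ → ℝ} {σ : ℝ → ℝ} {K : ℝ}
    (hp : ∀ n k, |p n k| ≤ K)
    (hlim : ∀ t ∈ Ioo (0 : ℝ) 1, Tendsto (fun n => p n ⌊t * m n⌋₊) atTop (𝓝 (σ t)))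
    {x : ℝ} (hx : x ∈ Ioo (0 : ℝ) 1) :
    Tendsto (fun n => (∑ k ∈ Finset.Ico ⌊x * m n⌋₊ (m n), W n k * p n k) / m n) atTop
      (𝓝 (∫ t in x..1, σ t / γ t)) := by
  have h1 := tendsto_integral_tail (F := fun n t => W n ⌊t * m n⌋₊ * p n ⌊t * m n⌋₊)
    (f := fun t => σ t / γ t) (C := C * K) (fun n => measurable_comp_floor_mul (fun k => W n k * p n k) _)
    (fun n t => by
      rw [abs_mul]
      exact mul_le_mul (h.abs_le _ _) (hp _ _) (abs_nonneg _) h.nonneg)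
    (fun t ht => by
      rw [div_eq_inv_mul]
      exact (h.tendsto t ht).mul (hlim t ht))
    (Ioo_subset_Icc_self hx) (tendsto_floor_mul_div h.tendsto_size hx.1.le)
  refine h1.congr fun n => ?_
  have hN : (0 : ℝ) < m n := by exact_mod_cast h.pos n
  have hle : ⌊x * m n⌋₊ ≤ m n := by
    refine Nat.floor_le_of_le ?_
    nlinarith [hx.2]
  have h2 := integral_comp_floor_mul (fun k => W n k * p n k) (h.pos n) hle
  rwa [div_self hN.ne'] at h2

theorem abs_tail_sum_le (h : ResistanceSequence γ C m W) {p : ℕ → ℕ → ℝ} {K : ℝ}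
    (hp : ∀ n k, |p n k| ≤ K) (n j : ℕ) :
    |(∑ k ∈ Finset.Ico j (m n), W n k * p n k) / m n| ≤ C * K := by
  have hN : (0 : ℝ) < m n := by exact_mod_cast h.pos n
  have hK : 0 ≤ K := (abs_nonneg _).trans (hp 0 0)
  rw [abs_div, abs_of_pos hN, div_le_iff₀ hN]
  calc |∑ k ∈ Finset.Ico j (m n), W n k * p n k|
      ≤ ∑ k ∈ Finset.Ico j (m n), C * K := by
        refine (Finset.abs_sum_le_sum_abs _ _).trans (Finset.sum_le_sum fun k _ => ?_)
        rw [abs_mul]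
        exact mul_le_mul (h.abs_le _ _) (hp _ _) (abs_nonneg _) h.nonneg
    _ = ((m n - j : ℕ) : ℝ) * (C * K) := by simp
    _ ≤ C * K * m n := by
        rw [mul_comm]
        exact mul_le_mul_of_nonneg_left (by exact_mod_cast Nat.sub_le _ _)
          (mul_nonneg h.nonneg hK)

end ResistanceSequence

/-- Cauchy–Schwarz up to index `N`; beyond it the partial sums are constant. -/
theorem abs_sum_range_div_le {N : ℕ} (hN : 0 < N) {u : ℕ → ℝ} (h0 : ∀ j, N ≤ j → u j = 0)
    (hsq : ∑ j ∈ Finset.range N, u j ^ 2 = N) (k : ℕ) :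
    |(∑ i ∈ Finset.range k, u i) / N| ≤ 1 := by
  have hN' : (0 : ℝ) < N := by exact_mod_cast hN
  have key : ∀ l ≤ N, |(∑ i ∈ Finset.range l, u i) / N| ≤ 1 := by
    intro l hl
    rw [abs_div, abs_of_pos hN', div_le_one hN']
    refine abs_le_of_sq_le_sq ?_ hN'.le
    calc (∑ i ∈ Finset.range l, u i) ^ 2 ≤ l * ∑ i ∈ Finset.range l, u i ^ 2 := by
          simpa using sq_sum_le_card_mul_sum_sq (s := Finset.range l) (f := u)
      _ ≤ N * ∑ i ∈ Finset.range N, u i ^ 2 := by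
          refine mul_le_mul (by exact_mod_cast hl) ?_ (Finset.sum_nonneg fun _ _ => sq_nonneg _)
            hN'.le
          exact Finset.sum_le_sum_of_subset_of_nonneg (Finset.range_mono hl)
            fun _ _ _ => sq_nonneg _
      _ = (N : ℝ) ^ 2 := by rw [hsq, sq]
  rcases le_total k N with hk | hk
  · exact key k hk
  · rw [← Finset.sum_subset (Finset.range_mono hk) fun j _ hj => h0 j (by simpa using hj)]
    exact key N le_rfl

/-! ### Compactness of the discrete eigenvectors. -/

/-- Normalised solutions of the rescaled discrete eigenvalue equations, in integrated form. -/
structure ScaledEigenSequence (γ : ℝ → ℝ) (C B : ℝ) (m : ℕ → ℕ) (W : ℕ → ℕ → ℝ) (lam l : ℕ → ℝ)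
    (u : ℕ → ℕ → ℝ) : Prop extends ResistanceSequence γ C m W where
  rate_mem : ∀ n, lam n ∈ Icc 0 B
  abs_boundary_le : ∀ n, |l n| ≤ 1
  tendsto_boundary : Tendsto l atTop (𝓝 0)
  eq_zero : ∀ n j, m n ≤ j → u n j = 0
  sum_sq : ∀ n, ∑ j ∈ Finset.range (m n), u n j ^ 2 = m n
  eq_sum : ∀ n, ∀ j < m n, u n j = lam n *
    ((∑ k ∈ Finset.Ico j (m n), W n k * ((∑ i ∈ Finset.range (k + 1), u n i) / m n)) / m n +
      l n * ((∑ i ∈ Finset.range (m n), u n i) / m n))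

/-- The primitive of the step function with values `u j` on a grid with `N` points. -/
noncomputable def stepPrimitive (N : ℕ) (u : ℕ → ℝ) (x : ℝ) : ℝ := ∫ t in (0 : ℝ)..x, u ⌊t * N⌋₊

namespace ScaledEigenSequence
variable {γ : ℝ → ℝ} {C B : ℝ} {m : ℕ → ℕ} {W : ℕ → ℕ → ℝ} {lam l : ℕ → ℝ} {u : ℕ → ℕ → ℝ}

theorem comp (h : ScaledEigenSequence γ C B m W lam l u) {s : ℕ → ℕ} (hs : Tendsto s atTop atTop) :
    ScaledEigenSequence γ C B (fun n => m (s n)) (fun n => W (s n)) (fun n => lam (s n))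
      (fun n => l (s n)) (fun n => u (s n)) where
  toResistanceSequence := h.toResistanceSequence.comp hs
  rate_mem _ := h.rate_mem _
  abs_boundary_le _ := h.abs_boundary_le _
  tendsto_boundary := h.tendsto_boundary.comp hs
  eq_zero _ := h.eq_zero _
  sum_sq _ := h.sum_sq _
  eq_sum _ := h.eq_sum _

theorem abs_mean_le (h : ScaledEigenSequence γ C B m W lam l u) (n k : ℕ) :
    |(∑ i ∈ Finset.range k, u n i) / m n| ≤ 1 :=
  abs_sum_range_div_le (h.pos n) (h.eq_zero n) (h.sum_sq n) k

theorem nonneg_bound (h : ScaledEigenSequence γ C B m W lam l u) : 0 ≤ B * (C + 1) :=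
  mul_nonneg ((h.rate_mem 0).1.trans (h.rate_mem 0).2) (by linarith [h.nonneg])

/-- The integrated equation upgrades the mean-square normalisation to a sup bound independent of
`n`, which makes the primitives equi-Lipschitz. -/
theorem abs_apply_le (h : ScaledEigenSequence γ C B m W lam l u) (n j : ℕ) :
    |u n j| ≤ B * (C + 1) := by
  rcases lt_or_ge j (m n) with hj | hj
  · rw [h.eq_sum n j hj, abs_mul, abs_of_nonneg (h.rate_mem n).1]
    refine mul_le_mul (h.rate_mem n).2 ((abs_add_le _ _).trans (add_le_add ?_ ?_)) (abs_nonneg _)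
      ((h.rate_mem n).1.trans (h.rate_mem n).2)
    · simpa using h.abs_tail_sum_le (K := 1) (fun n k => h.abs_mean_le n (k + 1)) n j
    · rw [abs_mul]
      exact mul_le_one₀ (h.abs_boundary_le n) (abs_nonneg _) (h.abs_mean_le n _)
  · rw [h.eq_zero n j hj, abs_zero]
    exact h.nonneg_bound

theorem abs_stepPrimitive_sub_le (h : ScaledEigenSequence γ C B m W lam l u) (n : ℕ) (x y : ℝ) :
    |stepPrimitive (m n) (u n) x - stepPrimitive (m n) (u n) y| ≤ B * (C + 1) * |x - y| := by
  have hi := fun a b => intervalIntegrable_of_abs_le (measurable_comp_floor_mul (u n) (m n))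
    (fun t => h.abs_apply_le n _) a b
  rw [stepPrimitive, stepPrimitive, integral_interval_sub_left (hi _ _) (hi _ _), ← Real.norm_eq_abs]
  exact norm_integral_le_of_norm_le_const fun t _ => h.abs_apply_le n _

theorem mean_eq_stepPrimitive (h : ScaledEigenSequence γ C B m W lam l u) (n k : ℕ) :
    (∑ i ∈ Finset.range k, u n i) / m n = stepPrimitive (m n) (u n) (k / m n) := by
  have := integral_comp_floor_mul (u n) (h.pos n) (Nat.zero_le k)
  rw [Finset.range_eq_Ico, ← this, stepPrimitive]
  simp

/-- Limits of normalised discrete eigenvectors are eigenfunctions of the continuum problem. -/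
theorem isIntegratedSolution_of_tendsto (h : ScaledEigenSequence γ C B m W lam l u)
    (hγ : ContinuousOn γ (Icc 0 1)) (hpos : ∀ x ∈ Icc (0 : ℝ) 1, 0 < γ x)
    {μ : ℝ} (hμ : Tendsto lam atTop (𝓝 μ)) {σ : ℝ → ℝ} (hσ : ContinuousOn σ (Icc 0 1))
    (hlim : ∀ x ∈ Icc (0 : ℝ) 1,
      Tendsto (fun n => stepPrimitive (m n) (u n) x) atTop (𝓝 (σ x))) :
    ∃ φ, IsIntegratedSolution γ μ φ ∧ ∫ x in (0 : ℝ)..1, φ x ^ 2 = 1 := by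
  set φ : ℝ → ℝ := fun x => μ * ∫ s in x..1, σ s / γ s with hφ
  -- Partial sums are primitives at grid points tending to `t`; the common Lipschitz constant
  -- absorbs the displacement.
  have hmean : ∀ t ∈ Ioo (0 : ℝ) 1,
      Tendsto (fun n => (∑ i ∈ Finset.range (⌊t * m n⌋₊ + 1), u n i) / m n) atTop (𝓝 (σ t)) := by
    intro t ht
    have h1 : Tendsto (fun n => (⌊t * m n⌋₊ + 1 : ℕ) / (m n : ℝ) - t) atTop (𝓝 0) := by
      have h2 := ((tendsto_floor_mul_div h.tendsto_size ht.1.le).add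
        (tendsto_one_div_atTop_nhds_zero_nat.comp h.tendsto_size)).sub_const t
      rw [add_zero, sub_self] at h2
      refine h2.congr fun n => ?_
      simp only [Function.comp_apply]
      push_cast
      ring
    have h3 : Tendsto (fun n => stepPrimitive (m n) (u n) ((⌊t * m n⌋₊ + 1 : ℕ) / (m n : ℝ)) -
        stepPrimitive (m n) (u n) t) atTop (𝓝 0) :=
      squeeze_zero_norm (fun n => h.abs_stepPrimitive_sub_le n _ _)
        (by simpa using h1.abs.const_mul (B * (C + 1)))
    have h4 := h3.add (hlim t (Ioo_subset_Icc_self ht))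
    rw [zero_add] at h4
    refine h4.congr fun n => ?_
    rw [h.mean_eq_stepPrimitive]
    ring
  -- Convergence of the primitives becomes pointwise convergence of the eigenvectors through the
  -- integrated equation; the boundary term dies with `l n`.
  have hU : ∀ x ∈ Ioo (0 : ℝ) 1, Tendsto (fun n => u n ⌊x * m n⌋₊) atTop (𝓝 (φ x)) := by
    intro x hx
    have h1 := h.tendsto_tail_sum (K := 1) (fun n k => h.abs_mean_le n (k + 1)) hmean hx
    have h2 : Tendsto (fun n => l n * ((∑ i ∈ Finset.range (m n), u n i) / m n)) atTop (𝓝 0) := by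
      refine squeeze_zero_norm (a := fun n => |l n|) (fun n => ?_)
        (by simpa using h.tendsto_boundary.abs)
      rw [Real.norm_eq_abs, abs_mul]
      exact mul_le_of_le_one_right (abs_nonneg _) (h.abs_mean_le n _)
    have h3 := hμ.mul (h1.add h2)
    rw [add_zero] at h3
    refine h3.congr fun n => (h.eq_sum n _ ?_).symm
    have hN : (0 : ℝ) < m n := by exact_mod_cast h.pos n
    refine (Nat.floor_lt (by nlinarith [hx.1])).2 ?_
    nlinarith [hx.2]
  have hσeq : ∀ x ∈ Icc (0 : ℝ) 1, σ x = ∫ t in (0 : ℝ)..x, φ t := fun x hx =>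
    tendsto_nhds_unique (hlim x hx) (tendsto_integral_of_bounded
      (fun n => measurable_comp_floor_mul (u n) (m n)) (fun n t => h.abs_apply_le n _) hU
      (left_mem_Icc.2 zero_le_one) hx)
  have hc : ContinuousOn (fun s => σ s / γ s) (Icc 0 1) := hσ.div hγ fun x hx => (hpos x hx).ne'
  refine ⟨φ, ⟨?_, fun x hx => ?_⟩, ?_⟩
  · have h1 : ContinuousOn (fun x => μ * ((∫ s in (0 : ℝ)..1, σ s / γ s) -
        ∫ s in (0 : ℝ)..x, σ s / γ s)) (Icc 0 1) :=
      continuousOn_const.mul (continuousOn_const.sub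
        fun x hx => (hasDerivWithinAt_integral hc hx).continuousWithinAt)
    exact h1.congr fun x hx => by rw [hφ]; beta_reduce; rw [integral_tail_eq hc hx]
  · rw [hφ]
    beta_reduce
    congr 1
    refine integral_congr fun s hs => ?_
    rw [uIcc_of_le hx.2] at hs
    rw [hσeq s ⟨hx.1.trans hs.1, hs.2⟩]
  -- Pointwise convergence with a uniform bound preserves the norm, so the limit is nontrivial.
  · have h1 := tendsto_integral_of_bounded (F := fun n t => u n ⌊t * m n⌋₊ ^ 2)
      (f := fun t => φ t ^ 2) (C := (B * (C + 1)) ^ 2)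
      (fun n => measurable_comp_floor_mul (fun k => u n k ^ 2) (m n))
      (fun n t => by
        rw [abs_pow]
        exact pow_le_pow_left₀ (abs_nonneg _) (h.abs_apply_le n _) 2)
      (fun t ht => (hU t ht).pow 2) (left_mem_Icc.2 zero_le_one) (right_mem_Icc.2 zero_le_one)
    refine tendsto_nhds_unique h1 (tendsto_const_nhds.congr fun n => ?_)
    have hN : (m n : ℝ) ≠ 0 := by exact_mod_cast (h.pos n).ne'
    have h2 := integral_comp_floor_mul (fun k => u n k ^ 2) (h.pos n) (Nat.zero_le (m n))
    rw [← Finset.range_eq_Ico, h.sum_sq n, div_self hN] at h2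
    simpa using h2.symm

open BoundedContinuousFunction in
/-- Compactness of normalised discrete eigenvectors. -/
theorem exists_subseq_limit (h : ScaledEigenSequence γ C B m W lam l u)
    (hγ : ContinuousOn γ (Icc 0 1)) (hpos : ∀ x ∈ Icc (0 : ℝ) 1, 0 < γ x) :
    ∃ (s : ℕ → ℕ) (μ : ℝ) (φ : ℝ → ℝ), Tendsto s atTop atTop ∧ Tendsto (fun n => lam (s n)) atTop (𝓝 μ) ∧
      IsIntegratedSolution γ μ φ ∧ ∫ x in (0 : ℝ)..1, φ x ^ 2 = 1 := by
  set D : ℝ := B * (C + 1) with hD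
  have hlip : ∀ n, LipschitzWith ⟨D, h.nonneg_bound⟩
      (fun x : Icc (0 : ℝ) 1 => stepPrimitive (m n) (u n) x) := fun n =>
    LipschitzWith.of_dist_le_mul fun x y => h.abs_stepPrimitive_sub_le n x y
  set S : ℕ → (Icc (0 : ℝ) 1 →ᵇ ℝ) := fun n => mkOfCompact ⟨_, (hlip n).continuous⟩ with hS
  have hbd : ∀ n (x : Icc (0 : ℝ) 1), S n x ∈ Icc (-D) D := by
    intro n x
    have h1 := h.abs_stepPrimitive_sub_le n x 0
    have h2 : stepPrimitive (m n) (u n) 0 = 0 := integral_same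
    rw [h2, sub_zero, sub_zero, abs_of_nonneg x.2.1] at h1
    exact abs_le.1 (h1.trans (mul_le_of_le_one_right h.nonneg_bound x.2.2))
  have hcomp : IsCompact (closure (range S)) := by
    refine arzela_ascoli (Icc (-D) D) isCompact_Icc (range S) ?_ ?_
    · rintro _ x ⟨n, rfl⟩
      exact hbd n x
    · refine (LipschitzWith.uniformEquicontinuous _ ⟨D, h.nonneg_bound⟩ ?_).equicontinuous
      rintro ⟨_, n, rfl⟩
      exact hlip n
  -- The rates lie in `Icc 0 B`, so one extraction in the product serves both primitives and rates.
  obtain ⟨⟨f, μ⟩, -, s, hs, hlim⟩ := (hcomp.prod (isCompact_Icc (a := (0 : ℝ)) (b := B))).tendsto_subseq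
    (x := fun n => (S n, lam n)) fun n => ⟨subset_closure ⟨n, rfl⟩, h.rate_mem n⟩
  have hlimS : Tendsto (fun n => S (s n)) atTop (𝓝 f) := (continuous_fst.tendsto _).comp hlim
  have hlimμ : Tendsto (fun n => lam (s n)) atTop (𝓝 μ) := (continuous_snd.tendsto _).comp hlim
  obtain ⟨φ, hφ⟩ := (h.comp hs.tendsto_atTop).isIntegratedSolution_of_tendsto hγ hpos hlimμ
    (σ := IccExtend zero_le_one f) (f.continuous.Icc_extend').continuousOn
    (fun x hx => by
      rw [IccExtend_of_mem _ _ hx]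
      exact ((continuous_eval_const (⟨x, hx⟩ : Icc (0 : ℝ) 1)).tendsto f).comp hlimS)
  exact ⟨s, μ, φ, hs.tendsto_atTop, hlimμ, hφ⟩

end ScaledEigenSequence

/-! ### Upper bound by discretising the flux of a test function. -/

/-- The variational bound for the test vector with prescribed flux `q`. -/
theorem decayRate_mul_le_of_flux {N : ℕ} (hN : 0 < N) {γ : ℕ → ℝ}
    (hγ : ∀ k, k + 1 < N → 0 < γ k) (L : ℝ) (q : ℕ → ℝ) :
    decayRate N γ L * ((∑ j ∈ Finset.range N,
        ((∑ k ∈ Finset.Ico j N, (N : ℝ) ^ 2 * resistance N γ k * q k) / N) ^ 2) / N) ≤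
      (∑ k ∈ Finset.range N, (N : ℝ) ^ 2 * resistance N γ k * q k ^ 2) / N := by
  obtain ⟨n, rfl⟩ : ∃ n, N = n + 1 := ⟨N - 1, by omega⟩
  have hN' : (0 : ℝ) < (n + 1 : ℕ) := by positivity
  set v : ℕ → ℝ := fun j => (∑ k ∈ Finset.Ico j (n + 1),
    ((n + 1 : ℕ) : ℝ) ^ 2 * resistance (n + 1) γ k * q k) / (n + 1 : ℕ) with hv
  have hlast : resistance (n + 1) γ n = 0 := by simp [resistance]
  -- The test vector vanishes in the last mode, so the dissipation `L` contributes nothing.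
  have hvn : v n = 0 := by simp [hv, hlast]
  have hdiff : ∀ k < n, γ k * (v (k + 1) - v k) ^ 2 =
      ((n + 1 : ℕ) : ℝ) ^ 2 * resistance (n + 1) γ k * q k ^ 2 := by
    intro k hk
    have h1 : v k = v (k + 1) + ((n + 1 : ℕ) : ℝ) ^ 2 * resistance (n + 1) γ k * q k /
        (n + 1 : ℕ) := by
      simp only [hv]
      rw [Finset.sum_eq_sum_Ico_succ_bot (by omega), add_div, add_comm]
    have h2 := (hγ k (by omega)).ne'
    have h3 : resistance (n + 1) γ k = (γ k)⁻¹ := by simp [resistance, hk]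
    rw [h1, h3]
    field_simp
    ring
  have key := decayRate_mul_sum_sq_le n γ L v
  rw [hvn, Finset.sum_congr rfl fun k hk => hdiff k (Finset.mem_range.1 hk)] at key
  rw [← mul_div_assoc]
  refine div_le_div_of_nonneg_right ?_ hN'.le
  refine key.trans (le_of_eq ?_)
  rw [Finset.sum_range_succ (fun k => ((n + 1 : ℕ) : ℝ) ^ 2 * resistance (n + 1) γ k * q k ^ 2) n,
    hlast]
  ring

/-- Discretising the flux γψ' instead of sampling ψ keeps only reciprocal couplings in the energy,
where they are bounded. -/
theorem ResistanceSequence.exists_upper_bound {γ : ℝ → ℝ} {C : ℝ} {m : ℕ → ℕ} {g : ℕ → ℕ → ℝ}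
    (h : ResistanceSequence γ C m fun n k => (m n : ℝ) ^ 2 * resistance (m n) (g n) k)
    (hg : ∀ n k, k + 1 < m n → 0 < g n k) (L : ℕ → ℝ)
    (hγ : ContinuousOn γ (Icc 0 1)) (hpos : ∀ x ∈ Icc (0 : ℝ) 1, 0 < γ x)
    {ψ : ℝ → ℝ} (hψ : ψ ∈ testClass) :
    ∃ r : ℕ → ℝ, Tendsto r atTop (𝓝 (energy γ ψ)) ∧
      ∀ᶠ n in atTop, decayRate (m n) (g n) (L n) ≤ r n := by
  obtain ⟨hs, hnorm, -, h1⟩ := hψ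
  set W : ℕ → ℕ → ℝ := fun n k => (m n : ℝ) ^ 2 * resistance (m n) (g n) k with hW
  have hq0 : ContinuousOn (fun x => γ x * deriv01 ψ x) (Icc 0 1) :=
    hγ.mul (contDiffOn_deriv01 hs).continuousOn
  set q : ℝ → ℝ := IccExtend zero_le_one ((Icc (0 : ℝ) 1).domRestrict fun x => γ x * deriv01 ψ x)
  have hqc : Continuous q := hq0.domRestrict.Icc_extend'
  have hq : ∀ x ∈ Icc (0 : ℝ) 1, q x = γ x * deriv01 ψ x := fun x hx => IccExtend_of_mem _ _ hx
  obtain ⟨Q, hQ⟩ : ∃ Q, ∀ x, |q x| ≤ Q := by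
    obtain ⟨Q, hQ⟩ := isCompact_Icc.exists_bound_of_continuousOn hq0
    exact ⟨Q, fun x => hQ _ (projIcc (0 : ℝ) 1 zero_le_one x).2⟩
  have hQ0 : 0 ≤ Q := (abs_nonneg _).trans (hQ 0)
  have hqlim : ∀ t ∈ Ioo (0 : ℝ) 1, Tendsto (fun n => q (⌊t * m n⌋₊ / m n)) atTop (𝓝 (q t)) :=
    fun t ht => (hqc.tendsto t).comp (tendsto_floor_mul_div h.tendsto_size ht.1.le)
  set V : ℕ → ℕ → ℝ := fun n j => (∑ k ∈ Finset.Ico j (m n), W n k * q (k / m n)) / m n with hV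
  have hVlim : ∀ x ∈ Ioo (0 : ℝ) 1, Tendsto (fun n => V n ⌊x * m n⌋₊) atTop (𝓝 (-ψ x)) := by
    intro x hx
    have h2 := h.tendsto_tail_sum (p := fun n k => q (k / m n)) (fun n k => hQ _) hqlim hx
    -- The quotient is ψ', and ψ(1) = 0. The sign is harmless since only squares enter.
    have h3 : ∫ t in x..1, q t / γ t = -ψ x := by
      have h4 := integral_eq_sub_of_hasDerivWithinAt hx.1.le hx.2.le le_rfl
        (fun y hy => hasDerivWithinAt_deriv01 hs hy) (contDiffOn_deriv01 hs).continuousOn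
      rw [h1, zero_sub] at h4
      rw [← h4]
      refine integral_congr fun t ht => ?_
      rw [uIcc_of_le hx.2.le] at ht
      have ht' : t ∈ Icc (0 : ℝ) 1 := ⟨hx.1.le.trans ht.1, ht.2⟩
      rw [hq t ht', mul_div_cancel_left₀ _ (hpos t ht').ne']
    rwa [h3] at h2
  have hmean : ∀ (a : ℕ → ℕ → ℝ) (f : ℝ → ℝ) (K : ℝ), (∀ n k, |a n k| ≤ K) →
      (∀ x ∈ Ioo (0 : ℝ) 1, Tendsto (fun n => a n ⌊x * m n⌋₊) atTop (𝓝 (f x))) →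
      Tendsto (fun n => (∑ k ∈ Finset.range (m n), a n k) / m n) atTop
        (𝓝 (∫ x in (0 : ℝ)..1, f x)) := by
    intro a f K ha hlim
    have h2 := tendsto_integral_of_bounded (F := fun n t => a n ⌊t * m n⌋₊)
      (fun n => measurable_comp_floor_mul (a n) (m n)) (fun n t => ha n _) hlim
      (left_mem_Icc.2 zero_le_one) (right_mem_Icc.2 zero_le_one)
    refine h2.congr fun n => ?_
    have hN : (m n : ℝ) ≠ 0 := by exact_mod_cast (h.pos n).ne'
    have h3 := integral_comp_floor_mul (a n) (h.pos n) (Nat.zero_le (m n))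
    rw [← Finset.range_eq_Ico, div_self hN] at h3
    simpa using h3
  have hA : Tendsto (fun n => (∑ j ∈ Finset.range (m n), V n j ^ 2) / m n) atTop (𝓝 1) := by
    have h2 := hmean (fun n j => V n j ^ 2) (fun x => (-ψ x) ^ 2) ((C * Q) ^ 2)
      (fun n j => by
        rw [abs_pow]
        exact pow_le_pow_left₀ (abs_nonneg _)
          (h.abs_tail_sum_le (p := fun n k => q (k / m n)) (fun n k => hQ _) n j) 2)
      (fun x hx => (hVlim x hx).pow 2)
    simpa only [neg_sq, hnorm] using h2
  have hE : Tendsto (fun n => (∑ k ∈ Finset.range (m n), W n k * q (k / m n) ^ 2) / m n) atTop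
      (𝓝 (energy γ ψ)) := by
    have h2 := hmean (fun n k => W n k * q (k / m n) ^ 2) (fun x => (γ x)⁻¹ * q x ^ 2) (C * Q ^ 2)
      (fun n k => by
        rw [abs_mul, abs_pow]
        exact mul_le_mul (h.abs_le n k) (pow_le_pow_left₀ (abs_nonneg _) (hQ _) 2)
          (by positivity) h.nonneg)
      (fun x hx => (h.tendsto x hx).mul ((hqlim x hx).pow 2))
    have h3 : ∫ x in (0 : ℝ)..1, (γ x)⁻¹ * q x ^ 2 = energy γ ψ := by
      refine integral_congr fun t ht => ?_
      rw [uIcc_of_le zero_le_one] at ht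
      have := (hpos t ht).ne'
      rw [hq t ht]
      field_simp
    rwa [h3] at h2
  refine ⟨_, by simpa using hE.div hA one_ne_zero, ?_⟩
  filter_upwards [hA.eventually (lt_mem_nhds zero_lt_one)] with n hn
  exact (le_div_iff₀ hn).2 (decayRate_mul_le_of_flux (h.pos n) (hg n) (L n) _)

/-! ### The continuum variational problem. -/

theorem testClass_nonempty : testClass.Nonempty := by
  -- The constant comes from ∫₀¹ (1 - x²)² = 8/15.
  refine ⟨fun x => √(15 / 8) * (1 - x ^ 2), ?_, ?_, ?_, by simp⟩
  · exact (contDiff_const.mul (contDiff_const.sub (contDiff_id.pow 2))).contDiffOn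
  · have h1 : ∀ x : ℝ, (√(15 / 8) * (1 - x ^ 2)) ^ 2 =
        15 / 8 - 15 / 4 * x ^ 2 + 15 / 8 * x ^ 4 := by
      intro x
      rw [mul_pow, Real.sq_sqrt (by norm_num)]
      ring
    simp only [h1]
    rw [intervalIntegral.integral_add, intervalIntegral.integral_sub]
    · simp only [intervalIntegral.integral_const_mul, integral_pow,
        intervalIntegral.integral_const]
      norm_num
    all_goals exact Continuous.intervalIntegrable (by fun_prop) _ _
  · refine deriv01_eq (left_mem_Icc.2 zero_le_one) (HasDerivAt.hasDerivWithinAt ?_)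
    have h1 := ((hasDerivAt_pow 2 (0 : ℝ)).const_sub 1).const_mul √(15 / 8)
    simpa using h1

theorem bddBelow_energy {γ : ℝ → ℝ} (hpos : ∀ x ∈ Icc (0 : ℝ) 1, 0 < γ x) :
    BddBelow (energy γ '' testClass) := by
  refine ⟨0, ?_⟩
  rintro _ ⟨φ, -, rfl⟩
  exact integral_nonneg zero_le_one fun x hx => mul_nonneg (hpos x hx).le (sq_nonneg _)

theorem integral_sq_pos {φ : ℝ → ℝ} (hφ : ContinuousOn φ (Icc 0 1))
    (hne : ∃ u ∈ Icc (0 : ℝ) 1, φ u ≠ 0) : 0 < ∫ u in (0 : ℝ)..1, φ u ^ 2 := by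
  obtain ⟨u, hu, hne⟩ := hne
  exact integral_pos zero_lt_one (hφ.pow 2) (fun _ _ => sq_nonneg _)
    ⟨u, hu, sq_pos_of_ne_zero hne⟩

theorem deriv01_const_mul (c : ℝ) (φ : ℝ → ℝ) (x : ℝ) :
    deriv01 (fun y => c * φ y) x = c * deriv01 φ x :=
  derivWithin_const_mul_field c

/-- Every eigenvalue is at most `-λ`. -/
theorem IsMixedEigenvalue.le_neg_limitRate {γ : ℝ → ℝ} (hγ : ContDiffOn ℝ ∞ γ (Icc 0 1))
    (hpos : ∀ x ∈ Icc (0 : ℝ) 1, 0 < γ x) {μ : ℝ} (h : IsMixedEigenvalue γ μ) :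
    μ ≤ -limitRate γ := by
  obtain ⟨φ, hs, hne, h0, h1, heq⟩ := h
  have hI := integral_sq_pos hs.continuousOn hne
  set I := ∫ u in (0 : ℝ)..1, φ u ^ 2 with hIdef
  have hE := energy_eq_of_eigen hγ hs h0 h1 heq
  have hc : (√I⁻¹) ^ 2 = I⁻¹ := Real.sq_sqrt (inv_pos.2 hI).le
  have hmem : (fun x => √I⁻¹ * φ x) ∈ testClass := by
    refine ⟨contDiffOn_const.mul hs, ?_, ?_, ?_⟩
    · simp only [mul_pow, hc, intervalIntegral.integral_const_mul]
      exact inv_mul_cancel₀ hI.ne'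
    · rw [deriv01_const_mul, h0, mul_zero]
    · simp [h1]
  have hE2 : energy γ (fun x => √I⁻¹ * φ x) = -μ := by
    have : ∀ u, γ u * deriv01 (fun x => √I⁻¹ * φ x) u ^ 2 = I⁻¹ * (γ u * deriv01 φ u ^ 2) := by
      intro u
      rw [deriv01_const_mul, mul_pow, hc]
      ring
    simp only [energy, this, intervalIntegral.integral_const_mul]
    rw [energy] at hE
    rw [hE, ← hIdef]
    field_simp
  have := csInf_le (bddBelow_energy hpos) ⟨_, hmem, hE2⟩
  rw [limitRate]
  linarith

/-- A normalised limit is itself an admissible competitor with energy `μ`, which bounds `limitRate`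
above by `μ`. -/
theorem IsIntegratedSolution.mem_testClass {γ φ : ℝ → ℝ} {μ : ℝ} (h : IsIntegratedSolution γ μ φ)
    (hγ : ContDiffOn ℝ ∞ γ (Icc 0 1)) (hpos : ∀ x ∈ Icc (0 : ℝ) 1, 0 < γ x)
    (hnorm : ∫ x in (0 : ℝ)..1, φ x ^ 2 = 1) :
    φ ∈ testClass ∧ energy γ φ = μ ∧ IsMixedEigenvalue γ (-μ) := by
  obtain ⟨h0, h1, heq⟩ := h.isMixedEigenvalue_data hγ hpos
  have hs := h.contDiffOn hγ hpos
  refine ⟨⟨hs, hnorm, h0, h1⟩, ?_, φ, hs, ?_, h0, h1, heq⟩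
  · rw [energy_eq_of_eigen hγ hs h0 h1 heq, hnorm]
    ring
  · by_contra! hzero
    have : ∫ x in (0 : ℝ)..1, φ x ^ 2 = ∫ x in (0 : ℝ)..1, (0 : ℝ) := by
      refine integral_congr fun x hx => ?_
      rw [uIcc_of_le zero_le_one] at hx
      simp [hzero x hx]
    rw [hnorm] at this
    simp at this

/-! ### The diffusive scaling and convergence of the rates. -/

section DiffusiveScaling
variable {γ : ℕ → ℕ → ℝ} {γlim : ℝ → ℝ} {c : ℝ} {M : ℕ}

/-- Grid sizes `max n M` turn eventual hypotheses into ones valid for every `n` without changing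
limits. Past the last link the resistance is zero, so the bound holds for all `k`. -/
theorem resistanceSequence_of_scaling (hc : 0 < c)
    (hpos : ∀ u ∈ Icc (0 : ℝ) 1, 0 < γlim u)
    (hconv : ∀ x ∈ Ioo (0 : ℝ) 1,
      Tendsto (fun N : ℕ => γ N ⌊x * N⌋₊ / (N : ℝ) ^ 2) atTop (𝓝 (γlim x)))
    (hM : 0 < M) (hlower : ∀ N, M ≤ N → ∀ j : ℕ, j + 1 < N → c ≤ γ N j / (N : ℝ) ^ 2) :
    ResistanceSequence γlim c⁻¹ (fun n => max n M)
      (fun n k => ((max n M : ℕ) : ℝ) ^ 2 * resistance (max n M) (γ (max n M)) k) where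
  pos n := hM.trans_le (le_max_right _ _)
  tendsto_size := tendsto_atTop_mono (fun n => le_max_left n M) tendsto_id
  abs_le n k := by
    by_cases hk : k + 1 < max n M
    · have h1 := hlower _ (le_max_right n M) k hk
      have h2 : ((max n M : ℕ) : ℝ) ^ 2 * resistance (max n M) (γ (max n M)) k =
          (γ (max n M) k / ((max n M : ℕ) : ℝ) ^ 2)⁻¹ := by
        rw [resistance, if_pos hk, inv_div, div_eq_mul_inv]
      rw [h2, abs_of_pos (inv_pos.2 (hc.trans_le h1))]
      exact inv_anti₀ hc h1
    · rw [resistance, if_neg hk, mul_zero, abs_zero]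
      positivity
  tendsto x hx := by
    refine ((hconv x hx).inv₀ (hpos x (Ioo_subset_Icc_self hx)).ne').congr' ?_
    have h1 : Tendsto (fun N : ℕ => (1 - x) * (N : ℝ)) atTop atTop :=
      tendsto_natCast_atTop_atTop.const_mul_atTop (by linarith [hx.2])
    filter_upwards [eventually_ge_atTop M, h1.eventually_gt_atTop 1] with N hN hN1
    have hk : ⌊x * N⌋₊ + 1 < N := by
      have h2 : (⌊x * N⌋₊ : ℝ) ≤ x * N := Nat.floor_le (mul_nonneg hx.1.le (Nat.cast_nonneg _))
      have h3 : ((⌊x * N⌋₊ + 1 : ℕ) : ℝ) < N := by push_cast; linarith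
      exact_mod_cast h3
    rw [max_eq_left hN, resistance, if_pos hk, inv_div, div_eq_mul_inv]

theorem exists_scaledEigenSequence {Λ : ℕ → ℝ} {B : ℝ} (hc : 0 < c)
    (hpos : ∀ u ∈ Icc (0 : ℝ) 1, 0 < γlim u)
    (hconv : ∀ x ∈ Ioo (0 : ℝ) 1,
      Tendsto (fun N : ℕ => γ N ⌊x * N⌋₊ / (N : ℝ) ^ 2) atTop (𝓝 (γlim x)))
    (hM : 0 < M) (hlower : ∀ N, M ≤ N → ∀ j : ℕ, j + 1 < N → c ≤ γ N j / (N : ℝ) ^ 2)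
    (hΛ : Tendsto (fun N : ℕ => Λ N / (N : ℝ)) atTop atTop)
    (hΛ1 : ∀ N, M ≤ N → 1 ≤ Λ N / (N : ℝ))
    (hB : ∀ N, M ≤ N → decayRate N (γ N) (Λ N) ≤ B) :
    ∃ u, ScaledEigenSequence γlim c⁻¹ B (fun n => max n M)
      (fun n k => ((max n M : ℕ) : ℝ) ^ 2 * resistance (max n M) (γ (max n M)) k)
      (fun n => decayRate (max n M) (γ (max n M)) (Λ (max n M)))
      (fun n => (Λ (max n M) / (max n M : ℕ))⁻¹) u := by
  have hR := resistanceSequence_of_scaling hc hpos hconv hM hlower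
  have key : ∀ N, M ≤ N → 0 ≤ decayRate N (γ N) (Λ N) ∧ ∃ u : ℕ → ℝ, (∀ j, N ≤ j → u j = 0) ∧
      ∑ j ∈ Finset.range N, u j ^ 2 = N ∧
      ∀ j < N, u j = decayRate N (γ N) (Λ N) *
        ((∑ k ∈ Finset.Ico j N, (N : ℝ) ^ 2 * resistance N (γ N) k *
          ((∑ i ∈ Finset.range (k + 1), u i) / N)) / N +
          (Λ N / N)⁻¹ * ((∑ i ∈ Finset.range N, u i) / N)) := by
    intro N hN
    have hN0 : (0 : ℝ) < N := by exact_mod_cast hM.trans_le hN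
    have hγ : ∀ k, k + 1 < N → 0 < γ N k := by
      intro k hk
      have h1 := hc.trans_le (hlower N hN k hk)
      exact (div_pos_iff_of_pos_right (by positivity)).1 h1
    have hL : 0 < Λ N := (div_pos_iff_of_pos_right hN0).1 (zero_lt_one.trans_le (hΛ1 N hN))
    obtain ⟨n, rfl⟩ : ∃ n, N = n + 1 := ⟨N - 1, by omega⟩
    obtain ⟨h0, u, hu0, husq, hueq⟩ := exists_principal_eigenvector n (γ (n + 1)) (Λ (n + 1))
      (fun k hk => hγ k (by omega)) hL
    refine ⟨h0, u, hu0, husq, fun j hj => ?_⟩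
    rw [hueq j hj]
    congr 2
    · rw [Finset.sum_div]
      refine Finset.sum_congr rfl fun k _ => ?_
      field_simp
    · field_simp
  choose h0 u hu0 husq hueq using key
  have hM' : ∀ n, M ≤ max n M := fun n => le_max_right _ _
  refine ⟨fun n => u _ (hM' n), hR, fun n => ⟨h0 _ (hM' n), hB _ (hM' n)⟩, fun n => ?_, ?_,
    fun n => hu0 _ (hM' n), fun n => husq _ (hM' n), fun n => hueq _ (hM' n)⟩
  · have h1 := hΛ1 _ (hM' n)
    rw [abs_of_nonneg (inv_nonneg.2 (zero_le_one.trans h1))]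
    exact inv_le_one_of_one_le₀ h1
  · exact tendsto_inv_atTop_zero.comp (hΛ.comp hR.tendsto_size)

theorem decayRate_tendsto {Λ : ℕ → ℝ}
    (hsmooth : ContDiffOn ℝ ∞ γlim (Icc 0 1)) (hpos : ∀ u ∈ Icc (0 : ℝ) 1, 0 < γlim u)
    (hconv : ∀ x ∈ Ioo (0 : ℝ) 1,
      Tendsto (fun N : ℕ => γ N ⌊x * N⌋₊ / (N : ℝ) ^ 2) atTop (𝓝 (γlim x)))
    (hlower : ∃ c : ℝ, 0 < c ∧ ∀ᶠ N : ℕ in atTop, ∀ j : ℕ, j + 1 < N → c ≤ γ N j / (N : ℝ) ^ 2)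
    (hΛ : Tendsto (fun N : ℕ => Λ N / (N : ℝ)) atTop atTop) :
    Tendsto (fun N => decayRate N (γ N) (Λ N)) atTop (𝓝 (limitRate γlim)) ∧
      IsMixedEigenvalue γlim (-limitRate γlim) := by
  obtain ⟨c, hc, hlower⟩ := hlower
  obtain ⟨M₀, hM₀⟩ := eventually_atTop.1
    ((eventually_gt_atTop 0).and (hlower.and (hΛ.eventually_ge_atTop 1)))
  have hupper : ∀ ψ ∈ testClass, ∃ r : ℕ → ℝ, Tendsto r atTop (𝓝 (energy γlim ψ)) ∧
      ∀ᶠ N in atTop, decayRate N (γ N) (Λ N) ≤ r N := by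
    intro ψ hψ
    have hR := resistanceSequence_of_scaling hc hpos hconv (hM₀ M₀ le_rfl).1
      (fun N hN => (hM₀ N hN).2.1)
    obtain ⟨r, hr, hle⟩ := hR.exists_upper_bound (fun n k hk => by
      have h1 := (hM₀ _ (le_max_right n M₀))
      have h2 : (0 : ℝ) < ((max n M₀ : ℕ) : ℝ) := by exact_mod_cast h1.1
      exact (div_pos_iff_of_pos_right (by positivity)).1 (hc.trans_le (h1.2.1 k hk)))
      (fun n => Λ (max n M₀)) hsmooth.continuousOn hpos hψ
    refine ⟨r, hr, ?_⟩
    filter_upwards [hle, eventually_ge_atTop M₀] with N hN hN'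
    rwa [max_eq_left hN'] at hN
  obtain ⟨ψ₀, hψ₀⟩ := testClass_nonempty
  obtain ⟨r₀, hr₀, hle₀⟩ := hupper ψ₀ hψ₀
  -- One fixed competitor `ψ₀` gives the a priori bound `B = energy γlim ψ₀ + 1` required for
  -- compactness.
  obtain ⟨M₁, hM₁⟩ := eventually_atTop.1
    (hle₀.and (hr₀.eventually (gt_mem_nhds (lt_add_one (energy γlim ψ₀)))))
  have hMM : ∀ N, max M₀ M₁ ≤ N → M₀ ≤ N := fun N hN => (le_max_left _ _).trans hN
  obtain ⟨u, hu⟩ := exists_scaledEigenSequence (M := max M₀ M₁) (B := energy γlim ψ₀ + 1) hc hpos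
    hconv (hM₀ _ (le_max_left _ _)).1 (fun N hN => (hM₀ N (hMM N hN)).2.1) hΛ
    (fun N hN => (hM₀ N (hMM N hN)).2.2)
    (fun N hN => have h := hM₁ N ((le_max_right _ _).trans hN); h.1.trans h.2.le)
  set M := max M₀ M₁
  -- Every sequence of sizes has a further subsequence with the same limit, which yields full
  -- convergence; the limit function also witnesses the eigenvalue.
  have hsub : ∀ t : ℕ → ℕ, Tendsto t atTop atTop → ∃ s : ℕ → ℕ,
      Tendsto (fun n => decayRate (max (t (s n)) M) (γ (max (t (s n)) M)) (Λ (max (t (s n)) M)))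
        atTop (𝓝 (limitRate γlim)) ∧ IsMixedEigenvalue γlim (-limitRate γlim) := by
    intro t ht
    obtain ⟨s, μ, φ, hst, hμ, hφ, hnorm⟩ :=
      (hu.comp ht).exists_subseq_limit hsmooth.continuousOn hpos
    obtain ⟨hmem, hE, heig⟩ := hφ.mem_testClass hsmooth hpos hnorm
    have hlo : limitRate γlim ≤ μ := csInf_le (bddBelow_energy hpos) ⟨φ, hmem, hE⟩
    have hhi : μ ≤ limitRate γlim := by
      refine le_csInf (testClass_nonempty.image _) ?_
      rintro _ ⟨ψ, hψ, rfl⟩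
      obtain ⟨r, hr, hle⟩ := hupper ψ hψ
      have hT : Tendsto (fun n => max (t (s n)) M) atTop atTop :=
        hu.tendsto_size.comp (ht.comp hst)
      exact le_of_tendsto_of_tendsto hμ (hr.comp hT) (hT.eventually hle)
    obtain rfl := le_antisymm hhi hlo
    exact ⟨s, hμ, heig⟩
  refine ⟨?_, (hsub id tendsto_id).choose_spec.2⟩
  have hmain : Tendsto (fun N => decayRate (max N M) (γ (max N M)) (Λ (max N M))) atTop
      (𝓝 (limitRate γlim)) :=
    tendsto_of_subseq_tendsto fun t ht => (hsub t ht).imp fun s hs => hs.1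
  refine hmain.congr' ?_
  filter_upwards [eventually_ge_atTop M] with N hN
  rw [max_eq_left hN]

end DiffusiveScaling

end ContinuumApprox

theorem mainTheorem5
    (γ : ℕ → ℕ → ℝ) (Λ : ℕ → ℝ) (γlim : ℝ → ℝ)
    (hsmooth : ContDiffOn ℝ ∞ γlim (Set.Icc 0 1))
    (hpos : ∀ u ∈ Set.Icc (0 : ℝ) 1, 0 < γlim u)
    (hconv : ∀ x ∈ Set.Ioo (0 : ℝ) 1,
      Filter.Tendsto (fun N : ℕ => γ N ⌊x * N⌋₊ / (N : ℝ) ^ 2) Filter.atTop (nhds (γlim x)))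
    (hlower : ∃ c : ℝ, 0 < c ∧ ∀ᶠ N : ℕ in Filter.atTop,
      ∀ j : ℕ, j + 1 < N → c ≤ γ N j / (N : ℝ) ^ 2)
    (hΛ : Filter.Tendsto (fun N : ℕ => Λ N / (N : ℝ)) Filter.atTop Filter.atTop) :
    (∀ N : ℕ, 1 ≤ N →
      IsGreatest (ContinuumApprox.eigenvalueSet (ContinuumApprox.modeMatrix N (γ N) (Λ N)))
        (ContinuumApprox.firstEigenvalue (ContinuumApprox.modeMatrix N (γ N) (Λ N)))) ∧
    Filter.Tendsto
      (fun N : ℕ => ContinuumApprox.firstEigenvalue (ContinuumApprox.modeMatrix N (γ N) (Λ N)))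
      Filter.atTop (nhds (-ContinuumApprox.limitRate γlim)) ∧
    IsGreatest {μ : ℝ | ContinuumApprox.IsMixedEigenvalue γlim μ}
      (-ContinuumApprox.limitRate γlim) := by
  obtain ⟨hlim, heig⟩ := ContinuumApprox.decayRate_tendsto hsmooth hpos hconv hlower hΛ
  refine ⟨fun N hN => ?_, ?_, heig, fun μ hμ => hμ.le_neg_limitRate hsmooth hpos⟩
  · have : NeZero N := ⟨by omega⟩
    exact ContinuumApprox.isGreatest_firstEigenvalue
      (ContinuumApprox.modeMatrix_isHermitian N (γ N) (Λ N))
  · simpa [ContinuumApprox.decayRate] using hlim.neg
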